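/- Consider the asynchronous shared memory model with one writer and $r$ readers, each a deterministic automaton (with arbitrarily many local states, kept from one operation to the next), which communicate only through $n$ physical registers. Each physical register is an atomic single-writer register with $b \ge 2$ possible values: every read or write of it is a single indivisible step, and only one process ever writes to it. The processes implement a single-writer register with $m$ possible values and a given initial value: the writer may invoke $\mathrm{write}(v)$ for any of the $m$ values $v$, and each reader may invoke $\mathrm{read}$. Suppose that the implementation is - *regular*: in every execution, each completed read returns the value of a write operation concurrent with it, or the value of the last write operation completed before the read begins (the initial value, if no write is completed before the read begins); - *obstruction-free*: if, at the end of any finite execution, a process with an operation in progress runs in isolation, then this operation terminates after finitely many steps; and that at least one reader is *invisible*, i.e. it never writes to a physical register in any execution. Then the implementation uses at least $$n \;\ge\; \left\lceil \frac{m-1}{b-1} \right\rceil$$ physical registers. -/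

import Mathlib

universe u

namespace RegisterSim

/-- The processes: one writer and `r` readers of the implemented register. -/
inductive Proc (r : ℕ) : Type
  | writer : Proc r
  | reader (q : Fin r) : Proc r
  deriving DecidableEq

/-- The argument of a high-level operation: the writer invokes `write x` with `x : Fin m`,
a reader invokes `read` (no argument). -/
abbrev Proc.Input (m : ℕ) {r : ℕ} : Proc r → Type
  | .writer => Fin m
  | .reader _ => Unit

/-- The response of a high-level operation: a write is acknowledged, a read returns a value. -/
abbrev Proc.Output (m : ℕ) {r : ℕ} : Proc r → Type
  | .writer => Unit
  | .reader _ => Fin m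

/-- What a process with an operation in progress does next, as determined by its local state:
read physical register `R` and move to the local state `k a`, where `a` is the value obtained;
write `a` to physical register `R` and move to the local state `s`;
or complete its operation with response `y`, keeping the local state `s`. -/
inductive Move (n b : ℕ) (σ : Type u) (ρ : Type) : Type u
  | read (R : Fin n) (k : Fin b → σ) : Move n b σ ρ
  | write (R : Fin n) (a : Fin b) (s : σ) : Move n b σ ρ
  | ret (y : ρ) (s : σ) : Move n b σ ρ

/-- An algorithm in the asynchronous shared memory model for simulating an `m`-valued register
with one writer and `r` readers on top of `n` physical `b`-valued registers.  Every process is a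
deterministic automaton with an arbitrary (possibly infinite) set of local states, which
persist from one operation to the next.  No correctness requirement is built in. -/
structure Algorithm (m n b r : ℕ) : Type (u + 1) where
  /-- initial value of the implemented register -/
  initVal : Fin m
  /-- initial values of the physical registers -/
  initReg : Fin n → Fin b
  /-- local states -/
  State : Proc r → Type u
  /-- initial local states -/
  initState : (p : Proc r) → State p
  /-- local state after the invocation of an operation -/
  invoke : (p : Proc r) → p.Input m → State p → State p
  /-- next move of a process that has an operation in progress -/
  next : (p : Proc r) → State p → Move n b (State p) (p.Output m)

/-- The events: invocation of an operation, read step, write step, response of an operation.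
Since the physical registers are atomic, a read or write of one is a single step. -/
inductive Event (m n b r : ℕ) : Type
  | invoke (p : Proc r) (x : p.Input m) : Event m n b r
  | read (p : Proc r) (R : Fin n) (a : Fin b) : Event m n b r
  | write (p : Proc r) (R : Fin n) (a : Fin b) : Event m n b r
  | ret (p : Proc r) (y : p.Output m) : Event m n b r

namespace Algorithm

variable {m n b r : ℕ}

/-- A configuration: the contents of all physical registers and the state of all processes,
where `busy p` records whether `p` has an operation in progress. -/
structure Config (A : Algorithm.{u} m n b r) : Type u where
  reg : Fin n → Fin b
  loc : (p : Proc r) → A.State p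
  busy : Proc r → Bool

/-- The initial configuration. -/
def initConfig (A : Algorithm.{u} m n b r) : A.Config where
  reg := A.initReg
  loc := A.initState
  busy := fun _ => false

/-- `A.Step C e C'`: event `e` can occur in configuration `C` and leads to `C'`. -/
inductive Step (A : Algorithm.{u} m n b r) : A.Config → Event m n b r → A.Config → Prop
  | invoke (C : A.Config) (p : Proc r) (x : p.Input m) (h : C.busy p = false) :
      Step A C (.invoke p x)
        ⟨C.reg, Function.update C.loc p (A.invoke p x (C.loc p)), Function.update C.busy p true⟩
  | read (C : A.Config) (p : Proc r) (R : Fin n) (k : Fin b → A.State p)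
      (h : C.busy p = true) (hnext : A.next p (C.loc p) = .read R k) :
      Step A C (.read p R (C.reg R))
        ⟨C.reg, Function.update C.loc p (k (C.reg R)), C.busy⟩
  | write (C : A.Config) (p : Proc r) (R : Fin n) (a : Fin b) (s : A.State p)
      (h : C.busy p = true) (hnext : A.next p (C.loc p) = .write R a s) :
      Step A C (.write p R a)
        ⟨Function.update C.reg R a, Function.update C.loc p s, C.busy⟩
  | ret (C : A.Config) (p : Proc r) (y : p.Output m) (s : A.State p)
      (h : C.busy p = true) (hnext : A.next p (C.loc p) = .ret y s) :
      Step A C (.ret p y)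
        ⟨C.reg, Function.update C.loc p s, Function.update C.busy p false⟩

/-- `A.Exec es C`: there is a finite execution of `A`, starting in the initial configuration, with
sequence of events `es` and final configuration `C`.  Every process may invoke operations
(the writer with any values) and take steps at arbitrary times; a process may also stop forever. -/
inductive Exec (A : Algorithm.{u} m n b r) : List (Event m n b r) → A.Config → Prop
  | nil : Exec A [] A.initConfig
  | snoc {es : List (Event m n b r)} {C : A.Config} {e : Event m n b r} {C' : A.Config} :
      Exec A es C → A.Step C e C' → Exec A (es ++ [e]) C'

/-- `SoloStep p C C'`: `C'` results from `C` by one step of `p` (reading or writing a physical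
register, or completing) of the operation that `p` has in progress. -/
def SoloStep (A : Algorithm.{u} m n b r) (p : Proc r) (C C' : A.Config) : Prop :=
  (∃ R a, A.Step C (.read p R a) C') ∨ (∃ R a, A.Step C (.write p R a) C') ∨
    (∃ y, A.Step C (.ret p y) C')

/-- Obstruction-freedom: whenever a process `p` with an operation in progress is run alone from the
end of any execution, its operation completes after finitely many steps.  (Steps of `p` are
deterministic, so there is only one solo run of the operation.) -/
def ObstructionFree (A : Algorithm.{u} m n b r) : Prop :=
  ∀ es C, A.Exec es C → ∀ p, C.busy p = true →
    ∃ C', Relation.ReflTransGen (A.SoloStep p) C C' ∧ C'.busy p = false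

/-- The physical registers are single-writer: each has an owner, the only process that ever
writes to it. -/
def SingleWriter (A : Algorithm.{u} m n b r) : Prop :=
  ∃ owner : Fin n → Proc r, ∀ es C, A.Exec es C →
    ∀ p R a, Event.write p R a ∈ es → p = owner R

/-- Reader `q` is invisible: it never writes to a physical register, in any execution. -/
def Invisible (A : Algorithm.{u} m n b r) (q : Fin r) : Prop :=
  ∀ es C, A.Exec es C → ∀ R a, Event.write (.reader q) R a ∉ es

end Algorithm

section Histories

variable {m n b r : ℕ}

/-- In `es`, an operation `read` by reader `q` is invoked at position `i` and it returns `v`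
at position `j`. -/
def IsRead (es : List (Event m n b r)) (q : Fin r) (v : Fin m) (i j : ℕ) : Prop :=
  i < j ∧ es[i]? = some (.invoke (.reader q) ()) ∧ es[j]? = some (.ret (.reader q) v) ∧
    ∀ k, i < k → k < j → ∀ v' : Fin m, es[k]? ≠ some (.ret (.reader q) v')

/-- In `es`, an operation `write v` is invoked at position `k`. -/
def IsWrite (es : List (Event m n b r)) (v : Fin m) (k : ℕ) : Prop :=
  es[k]? = some (.invoke .writer v)

/-- The write invoked at position `k` is acknowledged before position `i`.  (The writer performs
its operations one after the other, so the first acknowledgement after `k` is that of this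
write.) -/
def WriteDoneBefore (es : List (Event m n b r)) (k i : ℕ) : Prop :=
  ∃ l, k < l ∧ l < i ∧ es[l]? = some (.ret .writer ())

/-- `v` may be returned under regular semantics by a read with invocation at position `i` and
response at position `j`: it is written by a write concurrent with the read (one that is invoked
before `j` and not completed before `i`), or by the last write completed before `i`, or no write is
completed before `i` and `v` is the initial value. -/
def RegularValue (v₀ : Fin m) (es : List (Event m n b r)) (v : Fin m) (i j : ℕ) : Prop :=
  (∃ k, IsWrite es v k ∧ k < j ∧ ¬ WriteDoneBefore es k i) ∨
  (∃ k, IsWrite es v k ∧ WriteDoneBefore es k i ∧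
    ∀ v' k', IsWrite es v' k' → WriteDoneBefore es k' i → k' ≤ k) ∨
  (v = v₀ ∧ ∀ v' k', IsWrite es v' k' → ¬ WriteDoneBefore es k' i)

end Histories

/-- `A` implements a regular register: in every execution, every completed read returns a value
allowed by regular semantics. -/
def Algorithm.Regular {m n b r : ℕ} (A : Algorithm.{u} m n b r) : Prop :=
  ∀ es C, A.Exec es C → ∀ q v i j, IsRead es q v i j → RegularValue A.initVal es v i j

end RegisterSim

/-!
Let the writer write only values from a set `S`, and call a pair `(R, a)` attainable if register `R`
can still come to hold `a`.  The set of attainable pairs only shrinks as the writer runs, so the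
writer can reach a point from which it is stable: every attainable pair then recurs forever.

Suppose that `c` is the contents of the registers after a completed `write v`; a solo read of the
invisible reader on `c` returns `v`.  Consider instead a run from the same starting point in which
only values from a nonempty set `T ∌ v` are written, continued up to a stable point and a completed
write.  If all pairs `(R, c R)` were still attainable, then the writer could be scheduled so that
the reader finds `c R` in each register `R` that it accesses; as the reader leaves no trace, it
would again return `v`, against regularity.  Hence allowing one more value costs at least one more
attainable pair.  With a single value there are at least `n` attainable pairs, one for each
register, and with all `m` values at most `n * b`, so that `n + (m - 1) ≤ n * b`.
-/

namespace RegisterSim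

variable {m n b r : ℕ}

section Histories

/-- The process that takes part in an event. -/
def Event.proc : Event m n b r → Proc r
  | .invoke p _ | .read p _ _ | .write p _ _ | .ret p _ => p

/-- If the event is an invocation of the writer, then of `write v` for some `v ∈ S`. -/
def Event.WritesIn (S : Set (Fin m)) (e : Event m n b r) : Prop :=
  ∀ v, e = .invoke .writer v → v ∈ S

/-- The event is an access of process `p` to a physical register. -/
inductive Event.IsAccess (p : Proc r) : Event m n b r → Prop
  | read (R : Fin n) (a : Fin b) : IsAccess p (.read p R a)
  | write (R : Fin n) (a : Fin b) : IsAccess p (.write p R a)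

/-- An event of the writer, in a run in which it writes only values from `S`. -/
def Event.IsWriterIn (S : Set (Fin m)) (e : Event m n b r) : Prop :=
  e.proc = .writer ∧ e.WritesIn S

/-- An event that may occur during a read of reader `q` while only values from `S` are written. -/
def Event.IsDuringRead (S : Set (Fin m)) (q : Fin r) (e : Event m n b r) : Prop :=
  e.WritesIn S ∧ ∀ v, e ≠ .ret (.reader q) v

/-- Some write in `es` is completed before position `i`, and from this write on only values from `S`
are written.  A regular read that begins at position `i` must then return a value in `S`. -/
def Settled (S : Set (Fin m)) (es : List (Event m n b r)) (i : ℕ) : Prop :=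
  ∃ k, (∃ w, IsWrite es w k) ∧ WriteDoneBefore es k i ∧ ∀ v k', k ≤ k' → IsWrite es v k' → v ∈ S

variable {S T : Set (Fin m)} {e : Event m n b r} {es es' : List (Event m n b r)} {i : ℕ}

theorem Event.WritesIn.mono (hST : S ⊆ T) (h : e.WritesIn S) : e.WritesIn T :=
  fun v hv => hST (h v hv)

theorem Event.IsWriterIn.mono (hST : S ⊆ T) (h : e.IsWriterIn S) : e.IsWriterIn T :=
  ⟨h.1, h.2.mono hST⟩

theorem Event.IsWriterIn.isDuringRead (h : e.IsWriterIn S) (q : Fin r) : e.IsDuringRead S q :=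
  ⟨h.2, by rintro v rfl; cases h.1⟩

theorem Event.IsAccess.writesIn {p : Proc r} (h : e.IsAccess p) (S : Set (Fin m)) :
    e.WritesIn S := by
  rintro v rfl
  cases h

theorem Event.IsAccess.isWriterIn (h : e.IsAccess .writer) (S : Set (Fin m)) : e.IsWriterIn S :=
  ⟨by cases h <;> rfl, h.writesIn S⟩

theorem Event.IsAccess.isDuringRead {p : Proc r} (h : e.IsAccess p) (S : Set (Fin m))
    (q : Fin r) : e.IsDuringRead S q :=
  ⟨h.writesIn S, by rintro v rfl; cases h⟩

theorem writesIn_ret (S : Set (Fin m)) (p : Proc r) (y : p.Output m) :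
    (Event.ret p y : Event m n b r).WritesIn S := by
  rintro v ⟨⟩

theorem getElem?_append_of_eq_some {α : Type*} {l : List α} {a : α} (h : l[i]? = some a)
    (l' : List α) : (l ++ l')[i]? = some a := by
  rw [List.getElem?_append_left (List.getElem?_eq_some_iff.1 h).1, h]

theorem Settled.append (h : Settled S es i) (h' : ∀ e ∈ es', e.WritesIn S) :
    Settled S (es ++ es') i := by
  obtain ⟨k, ⟨w, hw⟩, ⟨l, hkl, hli, hl⟩, hS⟩ := h
  refine ⟨k, ⟨w, getElem?_append_of_eq_some hw es'⟩,
    ⟨l, hkl, hli, getElem?_append_of_eq_some hl es'⟩, fun v k' hk hv => ?_⟩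
  rcases lt_or_ge k' es.length with hlt | hge
  · exact hS v k' hk (by rwa [IsWrite, List.getElem?_append_left hlt] at hv)
  · rw [IsWrite, List.getElem?_append_right hge] at hv
    exact h' _ (List.mem_of_getElem? hv) v rfl

theorem settled_of_write (pre : List (Event m n b r)) {w : Fin m} (hw : w ∈ S)
    (hes : ∀ e ∈ es, e.WritesIn S) :
    Settled S (pre ++ .invoke .writer w :: (es ++ [.ret .writer ()]))
      (pre ++ Event.invoke .writer w :: (es ++ [Event.ret .writer ()])).length := by
  have hwrites : ∀ e ∈ Event.invoke .writer w :: (es ++ [Event.ret .writer ()]), e.WritesIn S := by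
    rw [List.forall_mem_cons, List.forall_mem_append, List.forall_mem_singleton]
    exact ⟨fun v hv => by cases hv; exact hw, hes, writesIn_ret S .writer ()⟩
  refine ⟨pre.length, ⟨w, by simp [IsWrite]⟩,
    ⟨pre.length + 1 + es.length, by omega, by simp; omega, ?_⟩, fun v k hk hv => ?_⟩
  · rw [List.getElem?_append_right (by omega), Nat.add_assoc, Nat.add_sub_cancel_left,
      Nat.add_comm 1, List.getElem?_cons_succ, List.getElem?_concat_length]
  · rw [IsWrite, List.getElem?_append_right hk] at hv
    exact hwrites _ (List.mem_of_getElem? hv) v rfl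

theorem RegularValue.mem {v₀ v : Fin m} {j : ℕ} (hv : RegularValue v₀ es v i j)
    (hes : Settled S es i) : v ∈ S := by
  obtain ⟨k, ⟨w, hw⟩, hdone, hS⟩ := hes
  rcases hv with ⟨k', hv, -, hpending⟩ | ⟨k', hv, -, hlast⟩ | ⟨-, hnone⟩
  · refine hS v k' ?_ hv
    by_contra! hlt
    obtain ⟨l, hkl, hl⟩ := hdone
    exact hpending ⟨l, hlt.trans hkl, hl⟩
  · exact hS v k' (hlast w k hw hdone) hv
  · exact absurd hdone (hnone w k hw)

theorem isRead_append {q : Fin r} {y : Fin m} (es : List (Event m n b r))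
    (hes' : ∀ e ∈ es', ∀ v, e ≠ .ret (.reader q) v) :
    IsRead (es ++ [.invoke (.reader q) ()] ++ es' ++ [.ret (.reader q) y]) q y
      es.length (es ++ [Event.invoke (.reader q) ()] ++ es').length := by
  refine ⟨by simp, by simp, List.getElem?_concat_length, fun k hk hk' v hv => ?_⟩
  rw [List.getElem?_append_left hk', List.getElem?_append_right (by simpa using hk)] at hv
  exact hes' _ (List.mem_of_getElem? hv) v rfl

end Histories

namespace Algorithm

variable {A : Algorithm.{u} m n b r}

section Step

/-- Configurations that process `p` cannot distinguish. -/
def Config.Indist (p : Proc r) (C D : A.Config) : Prop :=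
  C.reg = D.reg ∧ C.loc p = D.loc p ∧ C.busy p = D.busy p

variable {C C' D D' : A.Config} {e : Event m n b r} {p : Proc r}

theorem Config.Indist.trans (h : C.Indist p C') (h' : C'.Indist p D) : C.Indist p D :=
  ⟨h.1.trans h'.1, h.2.1.trans h'.2.1, h.2.2.trans h'.2.2⟩

theorem Step.loc_eq (h : A.Step C e C') (hp : p ≠ e.proc) : C'.loc p = C.loc p := by
  cases h <;> exact Function.update_of_ne hp _ _

theorem Step.busy_eq (h : A.Step C e C') (hp : p ≠ e.proc) : C'.busy p = C.busy p := by
  cases h <;> first | rfl | exact Function.update_of_ne hp _ _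

theorem Step.exists_of_indist (h : A.Step C e C') (hCD : C.Indist e.proc D) :
    ∃ D', A.Step D e D' ∧ C'.Indist e.proc D' := by
  obtain ⟨reg, loc, busy⟩ := D
  obtain ⟨rfl, hloc, hbusy⟩ := hCD
  simp only at hloc hbusy
  cases h with
  | invoke p x h =>
    exact ⟨_, .invoke _ p x (hbusy.symm.trans h), rfl,
      by simpa [Event.proc] using congrArg (A.invoke p x) hloc, by simp [Event.proc]⟩
  | read p R k h hnext =>
    have hnext' := (congrArg (A.next p) hloc).symm.trans hnext
    exact ⟨_, .read ⟨C.reg, loc, busy⟩ p R k (hbusy.symm.trans h) hnext', rfl,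
      by simp [Event.proc], hbusy⟩
  | write p R a s h hnext =>
    have hnext' := (congrArg (A.next p) hloc).symm.trans hnext
    exact ⟨_, .write _ p R a s (hbusy.symm.trans h) hnext', rfl, by simp [Event.proc], hbusy⟩
  | ret p y s h hnext =>
    have hnext' := (congrArg (A.next p) hloc).symm.trans hnext
    exact ⟨_, .ret _ p y s (hbusy.symm.trans h) hnext', rfl,
      by simp [Event.proc], by simp [Event.proc]⟩

end Step

section Run

/-- A finite execution fragment from one configuration to another, all of whose events satisfy
`P`. -/
inductive Run (A : Algorithm.{u} m n b r) (P : Event m n b r → Prop) :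
    A.Config → List (Event m n b r) → A.Config → Prop
  | nil (C : A.Config) : Run A P C [] C
  | cons {C C' C'' : A.Config} {e : Event m n b r} {es : List (Event m n b r)} :
      P e → A.Step C e C' → Run A P C' es C'' → Run A P C (e :: es) C''

variable {P Q : Event m n b r → Prop} {C C' C'' D : A.Config} {es es' : List (Event m n b r)}
  {p : Proc r}

theorem Run.single {e : Event m n b r} (he : P e) (h : A.Step C e C') : A.Run P C [e] C' :=
  .cons he h (.nil C')

theorem Run.append (h : A.Run P C es C') (h' : A.Run P C' es' C'') :
    A.Run P C (es ++ es') C'' := by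
  induction h with
  | nil => exact h'
  | cons he hs _ ih => exact .cons he hs (ih h')

theorem Run.mono (hPQ : ∀ e, P e → Q e) (h : A.Run P C es C') : A.Run Q C es C' := by
  induction h with
  | nil => exact .nil _
  | cons he hs _ ih => exact .cons (hPQ _ he) hs ih

theorem Run.forall_mem (h : A.Run P C es C') : ∀ e ∈ es, P e := by
  induction h with
  | nil => exact List.forall_mem_nil _
  | cons he _ _ ih => exact List.forall_mem_cons.2 ⟨he, ih⟩

theorem Exec.append (hC : A.Exec es C) (h : A.Run P C es' C') : A.Exec (es ++ es') C' := by
  induction h generalizing es with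
  | nil => simpa using hC
  | cons _ hs _ ih => simpa using ih (hC.snoc hs)

theorem Run.loc_eq (h : A.Run P C es C') (hp : ∀ e, P e → p ≠ e.proc) :
    C'.loc p = C.loc p := by
  induction h with
  | nil => rfl
  | cons he hs _ ih => exact ih.trans (hs.loc_eq (hp _ he))

theorem Run.busy_eq (h : A.Run P C es C') (hp : ∀ e, P e → p ≠ e.proc) :
    C'.busy p = C.busy p := by
  induction h with
  | nil => rfl
  | cons he hs _ ih => exact ih.trans (hs.busy_eq (hp _ he))

theorem Run.exists_of_indist (h : A.Run P C es C') (hP : ∀ e, P e → e.proc = p)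
    (hCD : C.Indist p D) : ∃ D', A.Run P D es D' ∧ C'.Indist p D' := by
  induction h generalizing D with
  | nil => exact ⟨D, .nil D, hCD⟩
  | cons he hs _ ih =>
    obtain rfl := hP _ he
    obtain ⟨D', hs', hCD'⟩ := hs.exists_of_indist hCD
    obtain ⟨D'', hrun, hCD''⟩ := ih hCD'
    exact ⟨D'', .cons he hs' hrun, hCD''⟩

theorem exists_run_ret_of_soloStep (h : Relation.ReflTransGen (A.SoloStep p) C C')
    (hC : C.busy p = true) (hC' : C'.busy p = false) :
    ∃ es D y D', A.Run (Event.IsAccess p) C es D ∧ A.Step D (.ret p y) D' := by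
  induction h using Relation.ReflTransGen.head_induction_on with
  | refl => simp [hC] at hC'
  | head hs _ ih =>
    rcases hs with ⟨R, a, hs⟩ | ⟨R, a, hs⟩ | ⟨y, hs⟩
    · obtain ⟨es, D, y, D', hrun, hret⟩ := ih (by cases hs; assumption)
      exact ⟨_, D, y, D', .cons (.read R a) hs hrun, hret⟩
    · obtain ⟨es, D, y, D', hrun, hret⟩ := ih (by cases hs; assumption)
      exact ⟨_, D, y, D', .cons (.write R a) hs hrun, hret⟩
    · exact ⟨[], _, y, _, .nil _, hs⟩

theorem ObstructionFree.exists_run_ret (hof : A.ObstructionFree) (hex : A.Exec es C)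
    (hC : C.busy p = true) :
    ∃ es D y D', A.Run (Event.IsAccess p) C es D ∧ A.Step D (.ret p y) D' := by
  obtain ⟨C', hrun, hC'⟩ := hof _ _ hex p hC
  exact exists_run_ret_of_soloStep hrun hC hC'

end Run

section Writer

variable {C C' : A.Config} {es : List (Event m n b r)}

theorem ObstructionFree.exists_run_idle (hof : A.ObstructionFree) (hex : A.Exec es C)
    (S : Set (Fin m)) :
    ∃ es' C', A.Run (Event.IsWriterIn S) C es' C' ∧ C'.busy .writer = false := by
  cases hC : C.busy .writer with
  | false => exact ⟨[], C, .nil C, hC⟩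
  | true =>
    obtain ⟨es', D, y, D', hrun, hret⟩ := hof.exists_run_ret hex hC
    refine ⟨_, D', (hrun.mono fun e he => he.isWriterIn S).append
      (.single ⟨rfl, writesIn_ret S .writer y⟩ hret), ?_⟩
    cases hret
    simp

theorem ObstructionFree.exists_run_write (hof : A.ObstructionFree) (hex : A.Exec es C)
    {S : Set (Fin m)} {w : Fin m} (hw : w ∈ S) :
    ∃ es' C', A.Run (Event.IsWriterIn S) C es' C' ∧
      Settled S (es ++ es') (es ++ es').length := by
  obtain ⟨pre, C₁, hpre, hidle⟩ := hof.exists_run_idle hex S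
  have hinvoke := hpre.append (.single
    ⟨rfl, fun v hv => by cases hv; exact hw⟩ (.invoke C₁ .writer w hidle))
  obtain ⟨mid, C₂, y, C₃, hmid, hret⟩ :=
    hof.exists_run_ret (p := .writer) (hex.append hinvoke) (by simp)
  refine ⟨_, C₃, (hinvoke.append (hmid.mono fun e he => he.isWriterIn S)).append
    (.single ⟨rfl, writesIn_ret S .writer y⟩ hret), ?_⟩
  simpa only [List.append_assoc, List.cons_append, List.nil_append] using
    settled_of_write (es ++ pre) hw fun e he => (hmid.forall_mem e he).writesIn S

/-- The writer, running alone and writing only values from `S`, can get from `C` to `C'`. -/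
def WriterReach (S : Set (Fin m)) (C C' : A.Config) : Prop :=
  ∃ es, A.Run (Event.IsWriterIn S) C es C'

/-- The pairs `(R, a)` such that register `R` can come to hold `a` when the writer runs alone
from `C`, writing only values from `S`. -/
def attainable (S : Set (Fin m)) (C : A.Config) : Set (Fin n × Fin b) :=
  {x | ∃ C', WriterReach S C C' ∧ C'.reg x.1 = x.2}

/-- No attainable pair is lost when the writer runs alone from `C`, writing only values from
`S`. -/
def Stable (S : Set (Fin m)) (C : A.Config) : Prop :=
  ∀ C', WriterReach S C C' → attainable S C ⊆ attainable S C'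

variable {S T : Set (Fin m)} {C'' : A.Config}

theorem WriterReach.refl (S : Set (Fin m)) (C : A.Config) : WriterReach S C C :=
  ⟨[], .nil C⟩

theorem WriterReach.trans (h : WriterReach S C C') (h' : WriterReach S C' C'') :
    WriterReach S C C'' := by
  obtain ⟨es, hrun⟩ := h
  obtain ⟨es', hrun'⟩ := h'
  exact ⟨es ++ es', hrun.append hrun'⟩

theorem WriterReach.mono (hST : S ⊆ T) (h : WriterReach S C C') : WriterReach T C C' := by
  obtain ⟨es, hrun⟩ := h
  exact ⟨es, hrun.mono fun _ he => he.mono hST⟩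

theorem attainable_mono (hST : S ⊆ T) (C : A.Config) : attainable S C ⊆ attainable T C :=
  fun _ ⟨D, hD, hx⟩ => ⟨D, hD.mono hST, hx⟩

theorem WriterReach.attainable_subset (h : WriterReach S C C') :
    attainable S C' ⊆ attainable S C :=
  fun _ ⟨D, hD, hx⟩ => ⟨D, h.trans hD, hx⟩

theorem le_ncard_attainable (S : Set (Fin m)) (C : A.Config) : n ≤ (attainable S C).ncard := by
  have hsub : Set.range (fun R => (R, C.reg R)) ⊆ attainable S C := by
    rintro _ ⟨R, rfl⟩
    exact ⟨C, .refl S C, rfl⟩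
  have hinj : Function.Injective fun R => (R, C.reg R) := fun _ _ h => congrArg Prod.fst h
  calc n = (Set.range fun R => (R, C.reg R)).ncard := by
        rw [← Set.image_univ, Set.ncard_image_of_injective _ hinj, Set.ncard_univ, Nat.card_fin]
    _ ≤ (attainable S C).ncard := Set.ncard_le_ncard hsub

theorem ncard_attainable_le (S : Set (Fin m)) (C : A.Config) :
    (attainable S C).ncard ≤ n * b := by
  simpa using Set.ncard_le_card (attainable S C)

theorem Stable.of_writerReach (hC : Stable S C) (h : WriterReach S C C') : Stable S C' :=
  fun _ hD => h.attainable_subset.trans (hC _ (h.trans hD))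

theorem exists_writerReach_stable (S : Set (Fin m)) (C : A.Config) :
    ∃ C', WriterReach S C C' ∧ Stable S C' := by
  obtain ⟨C', hC', hmin⟩ := exists_minimalFor_of_wellFoundedLT (WriterReach S C) (attainable S)
    ⟨C, .refl S C⟩
  exact ⟨C', hC', fun D hD => hmin (hC'.trans hD) hD.attainable_subset⟩

end Writer

section Reader

variable {q : Fin r} {S : Set (Fin m)} {C C' D D' : A.Config} {es es' : List (Event m n b r)}

/-- Reader `q`, in local state `s` and obtaining `c R` whenever it reads register `R`, completes its
operation with response `y` and without writing. -/
inductive Sees (A : Algorithm.{u} m n b r) (q : Fin r) (c : Fin n → Fin b) :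
    A.State (.reader q) → Fin m → Prop
  | ret {s t : A.State (.reader q)} {y : Fin m} (h : A.next (.reader q) s = .ret y t) :
      Sees A q c s y
  | read {s : A.State (.reader q)} {R : Fin n} {k : Fin b → A.State (.reader q)} {y : Fin m}
      (h : A.next (.reader q) s = .read R k) (hk : Sees A q c (k (c R)) y) : Sees A q c s y

theorem Invisible.sees_of_run (hinv : A.Invisible q) (hex : A.Exec es C)
    (hrun : A.Run (Event.IsAccess (.reader q)) C es' D) {y : Fin m}
    (hret : A.Step D (.ret (.reader q) y) D') : A.Sees q C.reg (C.loc (.reader q)) y := by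
  induction hrun generalizing es with
  | nil => cases hret with | ret _ _ t _ hnext => exact .ret hnext
  | cons he hs _ ih =>
    have hex' := hex.snoc hs
    cases he with
    | read R a =>
      cases hs with | read _ _ k _ hnext => exact .read hnext (by simpa using ih hex' hret)
    | write R a => exact absurd (by simp) (hinv _ _ hex' R a)

theorem exists_step_read {R : Fin n} {k : Fin b → A.State (.reader q)}
    (hq : C.busy (.reader q) = true) (hnext : A.next (.reader q) (C.loc (.reader q)) = .read R k) :
    ∃ D, A.Step C (.read (.reader q) R (C.reg R)) D ∧ C.Indist .writer D ∧
      D.loc (.reader q) = k (C.reg R) ∧ D.busy (.reader q) = true := by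
  refine ⟨_, .read C (.reader q) R k hq hnext, ⟨rfl, ?_, rfl⟩, ?_, hq⟩ <;> simp

/-- The reader waits before each of its steps until the writer, to whom it is invisible, has
brought back `c R` into the register `R` to be read. -/
theorem Sees.exists_run {c : Fin n → Fin b} {s : A.State (.reader q)} {y : Fin m}
    (h : A.Sees q c s y) (hC : Stable S C) (hc : ∀ R, (R, c R) ∈ attainable S C)
    (hCD : C.Indist .writer D) (hs : D.loc (.reader q) = s) (hq : D.busy (.reader q) = true) :
    ∃ es D₁ D₂, A.Run (Event.IsDuringRead S q) D es D₁ ∧ A.Step D₁ (.ret (.reader q) y) D₂ := by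
  induction h generalizing C D with
  | ret h => exact ⟨[], D, _, .nil D, .ret D _ _ _ hq (hs ▸ h)⟩
  | @read s R k y h _ ih =>
    obtain ⟨C', hreach, hR⟩ := hc R
    obtain ⟨es, hrun⟩ := hreach
    obtain ⟨D', hrun', hCD'⟩ := hrun.exists_of_indist (fun _ he => he.1) hCD
    have hne : ∀ e : Event m n b r, e.IsWriterIn S → Proc.reader q ≠ e.proc := by
      rintro e ⟨he, -⟩
      simp [he]
    have hq' : D'.busy (.reader q) = true := (hrun'.busy_eq hne).trans hq
    have hs' : D'.loc (.reader q) = s := (hrun'.loc_eq hne).trans hs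
    obtain ⟨D'', hread, hD, hk, hq''⟩ := exists_step_read hq' (hs' ▸ h)
    have hR' : D'.reg R = c R := (congrFun hCD'.1 R).symm.trans hR
    obtain ⟨es', D₁, D₂, hrest, hret⟩ := ih (hC.of_writerReach ⟨es, hrun⟩)
      (fun R' => hC _ ⟨es, hrun⟩ (hc R')) (hCD'.trans hD) (hR' ▸ hk) hq''
    refine ⟨_, D₁, D₂, (hrun'.mono fun e he => he.isDuringRead q).append (.cons ?_ hread hrest),
      hret⟩
    exact (Event.IsAccess.read R _).isDuringRead S q

/-- The local state of reader `q` right after its first invocation. -/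
def readStart (A : Algorithm.{u} m n b r) (q : Fin r) : A.State (.reader q) :=
  A.invoke (.reader q) () (A.initState (.reader q))

/-- The execution with history `es` ends in `C`, with reader `q` idle and in its initial state. -/
structure Unread (q : Fin r) (es : List (Event m n b r)) (C : A.Config) : Prop where
  exec : A.Exec es C
  loc_eq : C.loc (.reader q) = A.initState (.reader q)
  busy_eq : C.busy (.reader q) = false

theorem unread_nil (A : Algorithm.{u} m n b r) (q : Fin r) : Unread q [] A.initConfig :=
  ⟨.nil, rfl, rfl⟩

theorem Unread.append (hC : Unread q es C) (h : A.Run (Event.IsWriterIn S) C es' C') :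
    Unread q (es ++ es') C' := by
  have hne : ∀ e : Event m n b r, e.IsWriterIn S → Proc.reader q ≠ e.proc := by
    rintro e ⟨he, -⟩
    simp [he]
  exact ⟨hC.exec.append h, (h.loc_eq hne).trans hC.loc_eq, (h.busy_eq hne).trans hC.busy_eq⟩

theorem Unread.exists_invoke (hC : Unread q es C) :
    ∃ D, A.Step C (.invoke (.reader q) ()) D ∧ C.Indist .writer D ∧
      D.loc (.reader q) = A.readStart q ∧ D.busy (.reader q) = true := by
  refine ⟨_, .invoke C (.reader q) () hC.busy_eq, ⟨rfl, ?_, ?_⟩, ?_, ?_⟩ <;>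
    simp [readStart, hC.loc_eq]

theorem Regular.mem_of_run {y : Fin m} (hreg : A.Regular) (hex : A.Exec es C)
    (hes : Settled S es es.length) (hinvoke : A.Step C (.invoke (.reader q) ()) C')
    (hrun : A.Run (Event.IsDuringRead S q) C' es' D)
    (hret : A.Step D (.ret (.reader q) y) D') : y ∈ S := by
  have hread := isRead_append (y := y) es fun e he => (hrun.forall_mem e he).2
  refine (hreg _ _ (((hex.snoc hinvoke).append hrun).snoc hret) _ _ _ _ hread).mem ?_
  refine ((hes.append ?_).append fun e he => (hrun.forall_mem e he).1).append ?_ <;>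
    rintro _ he v rfl <;> simp at he

theorem Regular.sees_of_settled {v : Fin m} (hreg : A.Regular) (hof : A.ObstructionFree)
    (hinv : A.Invisible q) (hC : Unread q es C) (hes : Settled {v} es es.length) :
    A.Sees q C.reg (A.readStart q) v := by
  obtain ⟨D, hinvoke, hCD, hloc, hbusy⟩ := hC.exists_invoke
  have hex := hC.exec.snoc hinvoke
  obtain ⟨es', D₁, y, D₂, hrun, hret⟩ := hof.exists_run_ret hex hbusy
  have hy : y ∈ ({v} : Set (Fin m)) := hreg.mem_of_run hC.exec hes hinvoke
    (hrun.mono fun e he => he.isDuringRead {v} q) hret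
  rw [hCD.1, ← hloc, ← Set.mem_singleton_iff.1 hy]
  exact hinv.sees_of_run hex hrun hret

theorem Regular.mem_of_sees {y : Fin m} {c : Fin n → Fin b} (hreg : A.Regular)
    (hC : Unread q es C) (hes : Settled S es es.length) (hst : Stable S C)
    (hc : ∀ R, (R, c R) ∈ attainable S C) (hy : A.Sees q c (A.readStart q) y) : y ∈ S := by
  obtain ⟨D, hinvoke, hCD, hloc, hbusy⟩ := hC.exists_invoke
  obtain ⟨es', D₁, D₂, hrun, hret⟩ := hy.exists_run hst hc hCD hloc hbusy
  exact hreg.mem_of_run hC.exec hes hinvoke hrun hret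

end Reader

section Counting

variable {q : Fin r} {C : A.Config} {es : List (Event m n b r)}

theorem Regular.exists_attainable_ssubset (hreg : A.Regular) (hof : A.ObstructionFree)
    (hinv : A.Invisible q) (hC : Unread q es C) {T : Set (Fin m)} (hT : T.Nonempty) {v : Fin m}
    (hv : v ∉ T) :
    ∃ es' C', A.Run (Event.IsWriterIn T) C es' C' ∧
      attainable T C' ⊂ attainable (insert v T) C := by
  obtain ⟨w, hw⟩ := hT
  obtain ⟨esv, Cv, hrunv, hsetv⟩ := hof.exists_run_write hC.exec (Set.mem_singleton v)
  have hsees := hreg.sees_of_settled hof hinv (hC.append hrunv) hsetv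
  obtain ⟨C₁, ⟨es₁, hrun₁⟩, hst₁⟩ := exists_writerReach_stable T C
  have hC₁ := hC.append hrun₁
  obtain ⟨es₂, C₂, hrun₂, hset₂⟩ := hof.exists_run_write hC₁.exec hw
  have hrun := hrun₁.append hrun₂
  refine ⟨_, C₂, hrun, (WriterReach.attainable_subset ⟨_, hrun⟩).trans
    (attainable_mono (Set.subset_insert v T) C), fun hsub => hv ?_⟩
  refine hreg.mem_of_sees (hC₁.append hrun₂) hset₂ (hst₁.of_writerReach ⟨es₂, hrun₂⟩)
    (fun R => hsub ⟨Cv, ?_, rfl⟩) hsees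
  exact WriterReach.mono (Set.singleton_subset_iff.2 (Set.mem_insert v T)) ⟨esv, hrunv⟩

theorem Regular.add_card_le_ncard_attainable (hreg : A.Regular) (hof : A.ObstructionFree)
    (hinv : A.Invisible q) (hC : Unread q es C) {S : Finset (Fin m)} (hS : S.Nonempty) :
    n + S.card ≤ (attainable (S : Set (Fin m)) C).ncard + 1 := by
  induction hS using Finset.Nonempty.cons_induction generalizing es C with
  | singleton v => simpa using le_ncard_attainable _ C
  | cons v T hv hT ih =>
    obtain ⟨es', C', hrun, hlt⟩ :=
      hreg.exists_attainable_ssubset hof hinv hC (T := (T : Set (Fin m))) hT hv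
    have hcard := Set.ncard_lt_ncard hlt
    have hT' := ih (hC.append hrun)
    rw [Finset.card_cons, Finset.coe_cons]
    omega

theorem Regular.add_le_mul_add_one (hreg : A.Regular) (hof : A.ObstructionFree)
    (hinv : A.Invisible q) : n + m ≤ n * b + 1 := by
  have hcard := hreg.add_card_le_ncard_attainable hof hinv (unread_nil A q)
    (S := Finset.univ) ⟨A.initVal, Finset.mem_univ _⟩
  rw [Finset.card_univ, Fintype.card_fin] at hcard
  exact hcard.trans (Nat.add_le_add_right (ncard_attainable_le _ _) 1)

end Counting

end Algorithm

end RegisterSim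

theorem theorem1_general {m n b r : ℕ} (hb : 2 ≤ b) (A : RegisterSim.Algorithm.{u} m n b r)
    (hreg : A.Regular) (hof : A.ObstructionFree) (hinv : ∃ q : Fin r, A.Invisible q) :
    ⌈((m : ℚ) - 1) / ((b : ℚ) - 1)⌉ ≤ (n : ℤ) := by
  obtain ⟨q, hq⟩ := hinv
  have hcard : (n : ℚ) + m ≤ n * b + 1 := by exact_mod_cast hreg.add_le_mul_add_one hof hq
  have hb' : (2 : ℚ) ≤ b := by exact_mod_cast hb
  rw [Int.ceil_le, div_le_iff₀ (by linarith)]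
  push_cast
  linarith

theorem theorem1 {m n b r : ℕ} (hb : 2 ≤ b)
    (A : RegisterSim.Algorithm.{u} m n b r)
    (hsw : A.SingleWriter) (hreg : A.Regular) (hof : A.ObstructionFree)
    (hinv : ∃ q : Fin r, A.Invisible q) :
    ⌈((m : ℚ) - 1) / ((b : ℚ) - 1)⌉ ≤ (n : ℤ) := theorem1_general hb A hreg hof hinv
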